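/- Let $P$ be a poset on $[n]=\{1,\dots,n\}$, with order $\le_P$. A set partition $\pi$ of $[n]$ is *$P$-transverse* if its blocks are antichains of $P$ and the preposet $P/\pi$ on its blocks (the transitive closure of: $B\le C$ if $p\le_P q$ for some $p\in B$, $q\in C$) is a poset. A permutation $\tau\in\mathfrak S_n$ is *$P$-transverse* if the partition of $[n]$ into its cycles (fixed points included) is $P$-transverse; $\mathrm{cyc}(\tau)$ is the number of cycles. A *linear extension* of $P$ is a permutation $\sigma=[\sigma_1,\dots,\sigma_n]$ in which $i$ stands before $j$ whenever $i<_P j$; $\mathcal L(P)$ is the set of these. *Standard form of a $P$-transverse $\tau$.* With $\pi$ the cycle partition of $\tau$, the blocks of level $k\ge 1$ are the minimal blocks of $P/\pi$ after all blocks of level less than $k$ are removed; the level of an element is that of its block. An element $x$ is *essential* if it has level $1$, or if $x>_P y$ for some $y$ whose level is one less than that of $x$. A standard form of $\tau$ is a listing of its cycles, each written $(x,\tau(x),\tau^2(x),\dots)$ with $x$ the largest (as an integer) essential element of the cycle, by increasing level and, within a level, by increasing first element. *$P$-left-to-right maxima of $\sigma\in\mathcal L(P)$.* Cut $\sigma$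 into consecutive segments, the levels $1,2,\dots$ of $\sigma$, each being the longest initial segment of what is left of $\sigma$ that is an antichain of $P$. Essential elements of $\sigma$ are defined from these levels as above. An element is a $P$-left-to-right maximum if it is essential and is a left-to-right maximum, in the usual sense, of the subsequence of essential elements of its level; $\mathsf{LRmax}_P(\sigma)$ is the number of these. *Poincaré polynomial.* Let $\mathcal K_P=\{x\in\mathbb R^n: x_i<x_j \text{ whenever } i<_P j\}$, let $L$ be the poset of all intersections of hyperplanes $\{x_i=x_j\}$, $i<j$ (including the empty intersection $V=\mathbb R^n$), ordered by reverse inclusion, and let $\mu$ be its Möbius function. Put $\mathsf{Poin}(P,t)=\sum_{X\in L,\ X\cap\mathcal K_P\ne\varnothing}|\mu(V,X)|\,t^{\operatorname{codim}X}$. **Theorem.** Every $P$-transverse permutation $\tau$ has exactly one standard form. Erasing its parentheses gives the one-line notation of a linear extension $\Phi(\tau)$ of $P$; the map $\Phi$ is a bijection from the $P$-transverse permutations to $\mathcal L(P)$, and $\mathrm{cyc}(\tau)=\mathsf{LRmax}_P(\Phi(\tau))$ for all $\tau$. Consequently $$\mathsf{Poin}(P,t)=\sum_{\sigma\in\mathcal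 L(P)}t^{\,n-\mathsf{LRmax}_P(\sigma)}.$$ If $P$ is an antichain, then all permutations in $\mathfrak S_n$ are $P$-transverse and are linear extensions of $P$, $\mathsf{LRmax}_P$ is the usual number of left-to-right maxima, and $\Phi$ is the fundamental bijection (write each cycle with its largest element first, list the cycles by increasing largest element, erase the parentheses). -/

import Mathlib

namespace PosetCone

noncomputable section

open Polynomial

/-! ### Central hyperplane arrangements, intersection posets and Poincaré polynomials of cones -/

section Arrangement

variable {V : Type*} [AddCommGroup V] [Module ℝ V]

open scoped Classical in
/-- All intersections of subfamilies of a finite family `A` of linear hyperplanes; the empty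
subfamily gives `V`. They are ordered by reverse inclusion, hence the order dual. -/
def intersections (A : Finset (Submodule ℝ V)) : Finset (Submodule ℝ V)ᵒᵈ :=
  A.powerset.image fun S => OrderDual.toDual (S.inf id)

/-- The intersection poset of `A`, ordered by reverse inclusion. -/
abbrev IntersectionPoset (A : Finset (Submodule ℝ V)) : Type _ :=
  {X : (Submodule ℝ V)ᵒᵈ // X ∈ intersections A}

/-- The subspace of `V` underlying an element of the intersection poset. -/
def IntersectionPoset.subspace {A : Finset (Submodule ℝ V)} (X : IntersectionPoset A) :
    Submodule ℝ V :=
  OrderDual.ofDual X.1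

/-- The minimal element of the intersection poset: the whole space `V`. -/
def IntersectionPoset.whole (A : Finset (Submodule ℝ V)) : IntersectionPoset A :=
  ⟨OrderDual.toDual ⊤, by
    classical
    exact Finset.mem_image.2 ⟨∅, Finset.empty_mem_powerset A, by simp⟩⟩

open scoped Classical in
instance (A : Finset (Submodule ℝ V)) : LocallyFiniteOrder (IntersectionPoset A) :=
  Fintype.toLocallyFiniteOrder

open scoped Classical in
/-- The Möbius function value `μ(V, X)` in the intersection poset. -/
def moebius (A : Finset (Submodule ℝ V)) (X : IntersectionPoset A) : ℤ :=
  IncidenceAlgebra.mu ℤ (IntersectionPoset.whole A) X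

open scoped Classical in
/-- The signless Whitney number `c_k(K)`: the sum of `|μ(V, X)|` over the intersections `X` of
codimension `k` that meet the cone `K`. -/
def whitney (A : Finset (Submodule ℝ V)) (K : Set V) (k : ℕ) : ℕ :=
  ∑ X : IntersectionPoset A with
    (((X.subspace : Set V) ∩ K).Nonempty ∧ Module.finrank ℝ (V ⧸ X.subspace) = k),
    (moebius A X).natAbs

/-- The Poincaré polynomial `∑ c_k(K) t^k`, `0 ≤ k ≤ dim V`, of a cone `K` of `A`. -/
def poincare (A : Finset (Submodule ℝ V)) (K : Set V) : ℕ[X] :=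
  ∑ k ∈ Finset.range (Module.finrank ℝ V + 1), C (whitney A K k) * X ^ k

end Arrangement

section Poset

variable {n : ℕ}

/-- The hyperplane `x_i = x_j` of `ℝⁿ`. -/
def braidHyperplane (i j : Fin n) : Submodule ℝ (Fin n → ℝ) where
  carrier := {x | x i = x j}
  add_mem' {x y} hx hy := by
    simp only [Set.mem_ofPred_eq, Pi.add_apply] at *
    rw [hx, hy]
  zero_mem' := rfl
  smul_mem' c x hx := by
    simp only [Set.mem_ofPred_eq, Pi.smul_apply] at *
    rw [hx]

open scoped Classical in
/-- The braid arrangement in `ℝⁿ`. -/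
def braidArrangement (n : ℕ) : Finset (Submodule ℝ (Fin n → ℝ)) :=
  (Finset.univ.filter fun p : Fin n × Fin n => p.1 < p.2).image
    fun p => braidHyperplane p.1 p.2

/-- The strict relation `i <_P j` of a poset on `[n]`. A poset on `[n]` is given by its relation
`P i j`, read `i ≤_P j`; the signs `<` and `≤` on `Fin n` always mean the order of the integers. -/
def StrictRel (P : Fin n → Fin n → Prop) (i j : Fin n) : Prop :=
  P i j ∧ i ≠ j

/-- The cone of the braid arrangement attached to a poset on `[n]`. -/
def posetCone (P : Fin n → Fin n → Prop) : Set (Fin n → ℝ) :=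
  {x | ∀ i j, StrictRel P i j → x i < x j}

/-- The Poincaré polynomial `Poin(P, t)`. -/
def Poin (P : Fin n → Fin n → Prop) : ℕ[X] :=
  poincare (braidArrangement n) (posetCone P)

/-! ### Transverse permutations and linear extensions -/

/-- The preposet `P/π` on the blocks of a set partition `π`. -/
def quotLE (P : Fin n → Fin n → Prop) (π : Setoid (Fin n)) : Quotient π → Quotient π → Prop :=
  Relation.TransGen fun B C => ∃ p q : Fin n, Quotient.mk π p = B ∧ Quotient.mk π q = C ∧ P p q

/-- `π` is `P`-transverse: its blocks are antichains of `P`, and `P/π` is a poset. -/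
def IsTransverse (P : Fin n → Fin n → Prop) (π : Setoid (Fin n)) : Prop :=
  (∀ p q, π p q → ¬ StrictRel P p q) ∧ ∀ B C, quotLE P π B C → quotLE P π C B → B = C

/-- The set partition of `[n]` into the cycles of `τ`, fixed points included. -/
abbrev cyclePartition (τ : Equiv.Perm (Fin n)) : Setoid (Fin n) :=
  Equiv.Perm.SameCycle.setoid τ

/-- The number of cycles of `τ`, fixed points included. -/
def cyc (τ : Equiv.Perm (Fin n)) : ℕ :=
  Nat.card (Quotient (cyclePartition τ))

open scoped Classical in
/-- The `P`-transverse permutations. -/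
def transversePerms (P : Fin n → Fin n → Prop) : Finset (Equiv.Perm (Fin n)) :=
  Finset.univ.filter fun τ => IsTransverse P (cyclePartition τ)

open scoped Classical in
/-- The linear extensions of `P`, as permutations in one-line notation `[σ 0, …, σ (n - 1)]`. -/
def linearExtensions (P : Fin n → Fin n → Prop) : Finset (Equiv.Perm (Fin n)) :=
  Finset.univ.filter fun σ => ∀ i j, StrictRel P i j → σ.symm i < σ.symm j

/-- Relative to a partition of `[n]` into levels `1, 2, …`, an element is essential if it has level
`1`, or if it is above an element of the preceding level. -/
def Essential (P : Fin n → Fin n → Prop) (level : Fin n → ℕ) (x : Fin n) : Prop :=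
  level x = 1 ∨ ∃ y, level y + 1 = level x ∧ StrictRel P y x

/-! ### Levels and the standard form of a transverse permutation -/

/-- The minimal blocks of `P/π` within a set `S` of blocks. -/
def minimalBlocks (P : Fin n → Fin n → Prop) (π : Setoid (Fin n)) (S : Set (Quotient π)) :
    Set (Quotient π) :=
  {B | B ∈ S ∧ ∀ C ∈ S, quotLE P π C B → C = B}

/-- The blocks that remain when all blocks of level at most `k` are removed. -/
def remainingBlocks (P : Fin n → Fin n → Prop) (π : Setoid (Fin n)) : ℕ → Set (Quotient π)
  | 0 => Set.univ
  | k + 1 => remainingBlocks P π k \ minimalBlocks P π (remainingBlocks P π k)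

/-- The level of a block: the `k ≥ 1` for which it is minimal among the blocks that remain when all
blocks of level less than `k` are removed. -/
def blockLevel (P : Fin n → Fin n → Prop) (π : Setoid (Fin n)) (B : Quotient π) : ℕ :=
  sInf {k | ∃ m, k = m + 1 ∧ B ∈ minimalBlocks P π (remainingBlocks P π m)}

/-- The level of an element with respect to the cycle partition of `τ`. -/
def permLevel (P : Fin n → Fin n → Prop) (τ : Equiv.Perm (Fin n)) (x : Fin n) : ℕ :=
  blockLevel P (cyclePartition τ) (Quotient.mk _ x)

/-- The cycle of `τ` through `x`, written as `(x, τ x, τ² x, …)`. -/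
def cycleWord (τ : Equiv.Perm (Fin n)) (x : Fin n) : List (Fin n) :=
  List.iterate τ x (Function.minimalPeriod τ x)

/-- `xs` is the list of first elements of the cycles in the standard form of `τ`. -/
structure IsStandardForm (P : Fin n → Fin n → Prop) (τ : Equiv.Perm (Fin n))
    (xs : List (Fin n)) : Prop where
  /-- Every cycle is listed, through exactly one first element. -/
  cycles : ∀ y, ∃! x, x ∈ xs ∧ τ.SameCycle x y
  /-- The first element of a cycle is essential, and the largest essential element of the cycle. -/
  essential : ∀ x ∈ xs, Essential P (permLevel P τ) x
  maximal : ∀ x ∈ xs, ∀ y, τ.SameCycle x y → Essential P (permLevel P τ) y → y ≤ x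
  /-- The cycles are listed by increasing level and, within a level, by increasing first
  element. -/
  sorted : xs.Pairwise fun x y =>
    permLevel P τ x < permLevel P τ y ∨ (permLevel P τ x = permLevel P τ y ∧ x < y)

/-- The word obtained by listing the cycles with first elements `xs` and erasing parentheses. -/
def eraseParentheses (τ : Equiv.Perm (Fin n)) (xs : List (Fin n)) : List (Fin n) :=
  (xs.map (cycleWord τ)).flatten

/-! ### Levels and left-to-right maxima of a linear extension -/

/-- The number of entries of `σ` of level at most `k`: having cut off the first `t` entries, one
cuts off the longest initial segment of the rest that is an antichain of `P`. -/
def levelEnd (P : Fin n → Fin n → Prop) (σ : Equiv.Perm (Fin n)) : ℕ → ℕ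
  | 0 => 0
  | k + 1 => sSup {t | t ≤ n ∧
      IsAntichain P {x : Fin n | levelEnd P σ k ≤ (σ.symm x : ℕ) ∧ (σ.symm x : ℕ) < t}}

/-- The level of the element `x` in `σ`. -/
def wordLevel (P : Fin n → Fin n → Prop) (σ : Equiv.Perm (Fin n)) (x : Fin n) : ℕ :=
  sInf {k | (σ.symm x : ℕ) < levelEnd P σ k}

/-- `x` is essential in `σ`, and it is a left-to-right maximum of the subsequence of the essential
elements of `σ` that have the same level as `x`. -/
def IsPLRMax (P : Fin n → Fin n → Prop) (σ : Equiv.Perm (Fin n)) (x : Fin n) : Prop :=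
  Essential P (wordLevel P σ) x ∧
    ∀ y, Essential P (wordLevel P σ) y → wordLevel P σ y = wordLevel P σ x →
      σ.symm y ≤ σ.symm x → y ≤ x

/-- The number of `P`-left-to-right maxima of `σ`. -/
def PLRmax (P : Fin n → Fin n → Prop) (σ : Equiv.Perm (Fin n)) : ℕ :=
  Set.ncard {x | IsPLRMax P σ x}

/-! ### The fundamental bijection -/

/-- The number of left-to-right maxima of `σ` in the usual sense. -/
def LRmax (σ : Equiv.Perm (Fin n)) : ℕ :=
  Set.ncard {x : Fin n | ∀ y, σ.symm y ≤ σ.symm x → y ≤ x}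

open scoped Classical in
/-- The one-line notation of the image of `τ` under the fundamental bijection: write each cycle with
its largest element first, list the cycles by increasing largest element, erase parentheses. -/
def fundamentalWord (τ : Equiv.Perm (Fin n)) : List (Fin n) :=
  eraseParentheses τ
    ((Finset.univ.filter fun x : Fin n => ∀ y, τ.SameCycle x y → y ≤ x).sort (· ≤ ·))

end Poset

end

end PosetCone

/-
The standard form is the classical fundamental bijection for another total order of `[n]`: compare
first by the level of `τ`, then put the essential elements of a level last, then compare as
integers. Writing each cycle from its maximum for this weight and sorting the cycles by their maxima
gives a word whose levels are the levels of `τ` and whose records for the weight are its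
`P`-left-to-right maxima. As the levels of `τ` can be read off the word, the word determines the
weight, hence `τ`.

For the Poincaré polynomial, `μ(V, X)` is the sum of the signs of the permutations whose fixed space
is `X`: multiplication by a transposition cancels the signs of the permutations that fix a proper
flat pointwise, and this characterizes `μ`. The permutations with fixed space `X` share one cycle
partition, hence one sign, and `X` meets the cone exactly if that partition is `P`-transverse.
-/

namespace PosetCone

open Equiv Finset

section Levels

variable {n : ℕ} {P : Fin n → Fin n → Prop} {ℓ : Fin n → ℕ} {x : Fin n}

lemma Essential.one_le (h : Essential P ℓ x) : 1 ≤ ℓ x := by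
  rcases h with h | ⟨y, h, -⟩ <;> omega

/-! ### Levels of a set partition -/

section Partition

variable {π : Setoid (Fin n)}

/-- The properties that characterize the level function of the set partition `π` with respect
to `P`. -/
structure IsBlockLevel (P : Fin n → Fin n → Prop) (π : Setoid (Fin n)) (ℓ : Fin n → ℕ) :
    Prop where
  strict : ∀ p q, StrictRel P p q → ℓ p < ℓ q
  const : ∀ p q, π p q → ℓ p = ℓ q
  exists_essential : ∀ x, ∃ y, π x y ∧ Essential P ℓ y

lemma eq_or_lt_of_quotLE {α : Type*} [Preorder α] {f : Quotient π → α}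
    (hf : ∀ p q, StrictRel P p q → f (Quotient.mk π p) < f (Quotient.mk π q))
    {B C : Quotient π} (h : quotLE P π B C) : B = C ∨ f B < f C := by
  have generator : ∀ B C : Quotient π,
      (∃ p q : Fin n, Quotient.mk π p = B ∧ Quotient.mk π q = C ∧ P p q) → B = C ∨ f B < f C := by
    rintro _ _ ⟨p, q, rfl, rfl, hpq⟩
    rcases eq_or_ne p q with rfl | hne
    exacts [Or.inl rfl, Or.inr (hf p q ⟨hpq, hne⟩)]
  induction h with
  | single h => exact generator _ _ h
  | tail _ h ih =>
    rcases ih, generator _ _ h with ⟨rfl | hlt, rfl | hlt'⟩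
    exacts [Or.inl rfl, Or.inr hlt', Or.inr hlt, Or.inr (hlt.trans hlt')]

lemma isTransverse_of_strictMono {α : Type*} [Preorder α] {f : Quotient π → α}
    (hf : ∀ p q, StrictRel P p q → f (Quotient.mk π p) < f (Quotient.mk π q)) :
    IsTransverse P π := by
  refine ⟨fun p q hπ hP => (hf p q hP).ne (congrArg f (Quotient.sound hπ)), fun B C hBC hCB => ?_⟩
  rcases eq_or_lt_of_quotLE hf hBC, eq_or_lt_of_quotLE hf hCB with ⟨h | h, h' | h'⟩
  exacts [h, h, h'.symm, absurd h' h.asymm]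

namespace IsBlockLevel

lemma isTransverse (h : IsBlockLevel P π ℓ) : IsTransverse P π :=
  isTransverse_of_strictMono (f := Quotient.lift ℓ h.const) h.strict

lemma one_le (h : IsBlockLevel P π ℓ) (x : Fin n) : 1 ≤ ℓ x := by
  obtain ⟨y, hxy, hy⟩ := h.exists_essential x
  exact h.const x y hxy ▸ hy.one_le

lemma minimalBlocks_eq (h : IsBlockLevel P π ℓ) (k : ℕ) :
    minimalBlocks P π {B | k < Quotient.lift ℓ h.const B} =
      {B | Quotient.lift ℓ h.const B = k + 1} := by
  refine Set.Subset.antisymm ?_ fun B (hB : Quotient.lift ℓ h.const B = k + 1) => ?_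
  · rintro ⟨b⟩ ⟨hb : k < ℓ b, hmin⟩
    obtain ⟨x, hbx, hx⟩ := h.exists_essential b
    have hℓ := h.const b x hbx
    by_contra hne
    replace hne : ℓ b ≠ k + 1 := hne
    obtain hx | ⟨y, hy, hyx⟩ := hx
    · omega
    · have hyb := hmin (Quotient.mk π y) (show k < ℓ y by omega)
        (.single ⟨y, x, rfl, Quotient.sound (π.symm hbx), hyx.1⟩)
      have := h.const y b (Quotient.exact hyb)
      omega
  · refine ⟨show k < Quotient.lift ℓ h.const B by omega,
      fun C (hC : k < Quotient.lift ℓ h.const C) hCB => ?_⟩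
    exact (eq_or_lt_of_quotLE (f := Quotient.lift ℓ h.const) h.strict hCB).resolve_right
      fun hlt => by omega

lemma remainingBlocks_eq (h : IsBlockLevel P π ℓ) (k : ℕ) :
    remainingBlocks P π k = {B | k < Quotient.lift ℓ h.const B} := by
  induction k with
  | zero => exact (Set.eq_univ_of_forall fun B => Quotient.inductionOn B h.one_le).symm
  | succ k ih =>
    rw [remainingBlocks, ih, h.minimalBlocks_eq]
    ext B
    simp only [Set.mem_sdiff, Set.mem_ofPred_eq]
    omega

lemma blockLevel_eq (h : IsBlockLevel P π ℓ) (x : Fin n) :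
    blockLevel P π (Quotient.mk π x) = ℓ x := by
  have hx := h.one_le x
  have : {k | ∃ m, k = m + 1 ∧ Quotient.mk π x ∈ minimalBlocks P π (remainingBlocks P π m)} =
      {ℓ x} := by
    ext k
    simp only [h.remainingBlocks_eq, h.minimalBlocks_eq, Set.mem_ofPred_eq, Quotient.lift_mk,
      Set.mem_singleton_iff]
    exact ⟨by rintro ⟨m, rfl, hm⟩; exact hm.symm, fun hk => ⟨k - 1, by omega, by omega⟩⟩
  rw [blockLevel, this, csInf_singleton]

lemma permLevel_eq {τ : Perm (Fin n)} (h : IsBlockLevel P (cyclePartition τ) ℓ) :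
    permLevel P τ = ℓ :=
  funext h.blockLevel_eq

end IsBlockLevel

lemma exists_rank_of_wellFounded {α : Type*} [Finite α] {r : α → α → Prop} (hr : WellFounded r) :
    ∃ rank : α → ℕ, (∀ a b, r a b → rank a < rank b) ∧
      ∀ b, rank b = 0 ∨ ∃ a, r a b ∧ rank b = rank a + 1 := by
  classical
  cases nonempty_fintype α
  let F (b : α) (ih : ∀ a, r a b → ℕ) : ℕ := univ.sup fun a : {a // r a b} => ih a a.2 + 1
  have fix_eq (b : α) : hr.fix F b = univ.sup fun a : {a // r a b} => hr.fix F a + 1 :=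
    hr.fix_eq F b
  refine ⟨hr.fix F, fun a b hab => ?_, fun b => ?_⟩
  · rw [fix_eq b]
    exact le_sup (f := fun a : {a // r a b} => hr.fix F a + 1) (mem_univ ⟨a, hab⟩)
  · rcases isEmpty_or_nonempty {a // r a b} with h | h
    · exact Or.inl (by rw [fix_eq, univ_eq_empty, sup_empty, Nat.bot_eq_zero])
    · obtain ⟨a, -, ha⟩ :=
        exists_mem_eq_sup univ univ_nonempty fun a : {a // r a b} => hr.fix F a + 1
      exact Or.inr ⟨a, a.2, (fix_eq b).trans ha⟩

/-- The relation on the blocks of `π` induced by the strict relation of `P`. Unlike the order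
`quotLE` of `P/π`, it is not closed under transitivity. -/
def BlockRel (P : Fin n → Fin n → Prop) (π : Setoid (Fin n)) (B C : Quotient π) : Prop :=
  ∃ p q : Fin n, Quotient.mk π p = B ∧ Quotient.mk π q = C ∧ StrictRel P p q

lemma IsTransverse.wellFounded_blockRel (h : IsTransverse P π) :
    WellFounded (BlockRel P π) := by
  let lt (B C : Quotient π) : Prop := B ≠ C ∧ quotLE P π B C
  have : IsTrans _ lt := ⟨fun B C D hBC hCD =>
    ⟨fun hBD => hBC.1 (h.2 _ _ hBC.2 (hBD ▸ hCD.2)), hBC.2.trans hCD.2⟩⟩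
  have : Std.Irrefl lt := ⟨fun B hB => hB.1 rfl⟩
  refine Subrelation.wf ?_ (Finite.wellFounded_of_trans_of_irrefl lt)
  rintro _ _ ⟨p, q, rfl, rfl, hpq⟩
  exact ⟨fun hπ => h.1 p q (Quotient.exact hπ) hpq, .single ⟨p, q, rfl, rfl, hpq.1⟩⟩

lemma IsTransverse.exists_isBlockLevel (h : IsTransverse P π) : ∃ ℓ, IsBlockLevel P π ℓ := by
  obtain ⟨rank, hlt, hpred⟩ := exists_rank_of_wellFounded h.wellFounded_blockRel
  refine ⟨fun x => rank (Quotient.mk π x) + 1,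
    fun p q hpq => Nat.succ_lt_succ (hlt _ _ ⟨p, q, rfl, rfl, hpq⟩),
    fun p q hpq => by rw [Quotient.sound hpq], fun x => ?_⟩
  obtain hx | ⟨_, ⟨p, q, rfl, hqx, hpq⟩, hx⟩ := hpred (Quotient.mk π x)
  · exact ⟨x, π.refl x, Or.inl (congrArg Nat.succ hx)⟩
  · exact ⟨q, π.symm (Quotient.exact hqx), Or.inr ⟨p, congrArg Nat.succ (hqx ▸ hx.symm), hpq⟩⟩

lemma IsTransverse.isBlockLevel_permLevel {τ : Perm (Fin n)}
    (h : IsTransverse P (cyclePartition τ)) :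
    IsBlockLevel P (cyclePartition τ) (permLevel P τ) := by
  obtain ⟨ℓ, hℓ⟩ := h.exists_isBlockLevel
  rwa [hℓ.permLevel_eq]

end Partition

/-! ### Levels of a word -/

section Word

variable {σ : Perm (Fin n)}

/-- The properties that characterize the level function of the linear extension `σ` of `P`. -/
structure IsWordLevel (P : Fin n → Fin n → Prop) (σ : Perm (Fin n)) (ℓ : Fin n → ℕ) : Prop where
  strict : ∀ p q, StrictRel P p q → ℓ p < ℓ q
  mono : ∀ x y, σ.symm x ≤ σ.symm y → ℓ x ≤ ℓ y
  essential_of_first : ∀ x, (∀ y, σ.symm y < σ.symm x → ℓ y < ℓ x) → Essential P ℓ x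

namespace IsWordLevel

lemma symm_lt_symm (h : IsWordLevel P σ ℓ) (i j : Fin n) (hij : StrictRel P i j) :
    σ.symm i < σ.symm j :=
  not_le.1 fun hle => (h.strict i j hij).not_ge (h.mono _ _ hle)

lemma exists_essential_le (h : IsWordLevel P σ ℓ) (x : Fin n) :
    ∃ y, Essential P ℓ y ∧ ℓ y = ℓ x ∧ σ.symm y ≤ σ.symm x := by
  obtain ⟨y, hy, hmin⟩ := exists_min_image {y | ℓ y = ℓ x} σ.symm ⟨x, by simp⟩
  simp only [mem_filter, mem_univ, true_and] at hy hmin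
  refine ⟨y, h.essential_of_first y fun z hz => ?_, hy, hmin x rfl⟩
  exact (h.mono z y hz.le).lt_of_ne fun e => hz.not_ge (hmin z (e.trans hy))

lemma one_le (h : IsWordLevel P σ ℓ) (x : Fin n) : 1 ≤ ℓ x := by
  obtain ⟨y, hy, hyx, -⟩ := h.exists_essential_le x
  exact hyx ▸ hy.one_le

lemma le_of_forall_symm_lt {ℓ' : Fin n → ℕ} (h : IsWordLevel P σ ℓ) (h' : IsWordLevel P σ ℓ')
    (heq : ∀ y, σ.symm y < σ.symm x → ℓ y = ℓ' y) : ℓ' x ≤ ℓ x := by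
  by_contra! hlt
  have hess : Essential P ℓ' x := h'.essential_of_first x fun y hy =>
    heq y hy ▸ (h.mono y x hy.le).trans_lt hlt
  rcases hess with hx | ⟨y, hy, hyx⟩
  · have := h.one_le x
    omega
  · have := heq y (h.symm_lt_symm y x hyx)
    have := h.strict y x hyx
    omega

lemma unique {ℓ' : Fin n → ℕ} (h : IsWordLevel P σ ℓ) (h' : IsWordLevel P σ ℓ') : ℓ = ℓ' := by
  funext x
  induction x using (measure fun x => (σ.symm x : ℕ)).wf.induction with
  | _ x ih =>
    exact le_antisymm (h'.le_of_forall_symm_lt h fun y hy => (ih y hy).symm)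
      (h.le_of_forall_symm_lt h' ih)

end IsWordLevel

/-- The entries of `σ` in the positions `a, …, b - 1`. -/
def wordSegment (σ : Perm (Fin n)) (a b : ℕ) : Set (Fin n) :=
  {x | a ≤ (σ.symm x : ℕ) ∧ (σ.symm x : ℕ) < b}

lemma isGreatest_levelEnd_succ (k : ℕ) :
    IsGreatest {t | t ≤ n ∧ IsAntichain P (wordSegment σ (levelEnd P σ k) t)}
      (levelEnd P σ (k + 1)) := by
  have hbdd : BddAbove {t | t ≤ n ∧ IsAntichain P (wordSegment σ (levelEnd P σ k) t)} :=
    ⟨n, fun _ ht => ht.1⟩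
  exact ⟨Nat.sSup_mem ⟨0, n.zero_le, fun x hx => absurd hx.2 (Nat.not_lt_zero _)⟩ hbdd,
    fun t ht => le_csSup hbdd ht⟩

lemma levelEnd_le (k : ℕ) : levelEnd P σ k ≤ n := by
  cases k with
  | zero => exact n.zero_le
  | succ k => exact (isGreatest_levelEnd_succ k).1.1

lemma min_le_levelEnd_succ (k : ℕ) : min n (levelEnd P σ k + 1) ≤ levelEnd P σ (k + 1) := by
  refine (isGreatest_levelEnd_succ k).2 ⟨min_le_left _ _, fun x hx y hy hne => ?_⟩
  have := hx.1; have := hx.2; have := hy.1; have := hy.2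
  exact absurd (σ.symm.injective (Fin.ext (by omega))) hne

lemma levelEnd_mono : Monotone (levelEnd P σ) := by
  refine monotone_nat_of_le_succ fun k => ?_
  have := min_le_levelEnd_succ (P := P) (σ := σ) k
  have := levelEnd_le (P := P) (σ := σ) k
  omega

lemma min_le_levelEnd (k : ℕ) : min n k ≤ levelEnd P σ k := by
  induction k with
  | zero => simp
  | succ k ih =>
    have := min_le_levelEnd_succ (P := P) (σ := σ) k
    omega

lemma wordLevel_le_iff {k : ℕ} : wordLevel P σ x ≤ k ↔ (σ.symm x : ℕ) < levelEnd P σ k := by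
  refine ⟨fun h => ?_, fun h => Nat.sInf_le h⟩
  have hn : (σ.symm x : ℕ) < levelEnd P σ n :=
    (σ.symm x).isLt.trans_le (by simpa using min_le_levelEnd (P := P) (σ := σ) n)
  exact (Nat.sInf_mem (s := {k | (σ.symm x : ℕ) < levelEnd P σ k}) ⟨n, hn⟩).trans_le
    (levelEnd_mono h)

lemma wordLevel_eq_succ_iff {k : ℕ} : wordLevel P σ x = k + 1 ↔
    x ∈ wordSegment σ (levelEnd P σ k) (levelEnd P σ (k + 1)) := by
  rw [wordSegment, Set.mem_ofPred_eq, ← wordLevel_le_iff, ← not_lt, ← wordLevel_le_iff]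
  omega

lemma exists_wordLevel_eq_succ (P : Fin n → Fin n → Prop) (σ : Perm (Fin n)) (x : Fin n) :
    ∃ k, wordLevel P σ x = k + 1 := by
  refine Nat.exists_eq_add_of_le' (Nat.one_le_iff_ne_zero.2 fun h => ?_)
  exact Nat.not_lt_zero _ (wordLevel_le_iff.1 h.le)

lemma wordLevel_mono {y : Fin n} (h : σ.symm x ≤ σ.symm y) :
    wordLevel P σ x ≤ wordLevel P σ y :=
  wordLevel_le_iff.2 (lt_of_le_of_lt h (wordLevel_le_iff.1 le_rfl))

lemma not_strictRel_of_wordLevel_eq {y : Fin n} (h : wordLevel P σ x = wordLevel P σ y) :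
    ¬ StrictRel P x y := by
  obtain ⟨k, hk⟩ := exists_wordLevel_eq_succ P σ y
  exact fun hxy => (isGreatest_levelEnd_succ k).1.2 (wordLevel_eq_succ_iff.1 (h.trans hk))
    (wordLevel_eq_succ_iff.1 hk) hxy.2 hxy.1

lemma symm_eq_levelEnd_of_first {k : ℕ} (hk : wordLevel P σ x = k + 1)
    (hx : ∀ y, σ.symm y < σ.symm x → wordLevel P σ y < wordLevel P σ x) :
    (σ.symm x : ℕ) = levelEnd P σ k := by
  have hmem := wordLevel_eq_succ_iff.1 hk
  refine (hmem.1.eq_of_not_lt fun hlt => ?_).symm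
  let y := σ ⟨levelEnd P σ k, hlt.trans (σ.symm x).isLt⟩
  have hy : (σ.symm y : ℕ) = levelEnd P σ k := by simp [y]
  have : wordLevel P σ y = k + 1 :=
    wordLevel_eq_succ_iff.2 ⟨hy.ge, hy.trans_lt (hlt.trans hmem.2)⟩
  have := hx y (Fin.lt_def.2 (by rwa [hy]))
  omega

lemma exists_strictRel_of_symm_eq_levelEnd (hσ : ∀ i j, StrictRel P i j → σ.symm i < σ.symm j)
    {k : ℕ} (hx : (σ.symm x : ℕ) = levelEnd P σ (k + 1)) :
    ∃ y, wordLevel P σ y = k + 1 ∧ StrictRel P y x := by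
  have hnot : ¬ IsAntichain P (wordSegment σ (levelEnd P σ k) (levelEnd P σ (k + 1) + 1)) :=
    fun hanti => Nat.not_succ_le_self _
      ((isGreatest_levelEnd_succ k).2 ⟨hx ▸ (σ.symm x).isLt, hanti⟩)
  simp only [IsAntichain, Set.Pairwise, not_forall, Pi.compl_apply, compl_iff_not, not_not] at hnot
  obtain ⟨y, ⟨hy, -⟩, z, ⟨hz, hz'⟩, hne, hyz⟩ := hnot
  have hlt : (σ.symm y : ℕ) < σ.symm z := hσ y z ⟨hyz, hne⟩
  have hylevel : wordLevel P σ y = k + 1 := wordLevel_eq_succ_iff.2 ⟨hy, by omega⟩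
  have hzx : z = x := by
    by_contra hzx
    have := mt (fun e => σ.symm.injective (Fin.ext e)) hzx
    have hzlevel : wordLevel P σ z = k + 1 := wordLevel_eq_succ_iff.2 ⟨hz, by omega⟩
    exact not_strictRel_of_wordLevel_eq (hylevel.trans hzlevel.symm) ⟨hyz, hne⟩
  exact ⟨y, hylevel, hzx ▸ ⟨hyz, hne⟩⟩

lemma isWordLevel_wordLevel (hσ : ∀ i j, StrictRel P i j → σ.symm i < σ.symm j) :
    IsWordLevel P σ (wordLevel P σ) where
  strict p q hpq := (wordLevel_mono (hσ p q hpq).le).lt_of_ne fun h =>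
    not_strictRel_of_wordLevel_eq h hpq
  mono _ _ := wordLevel_mono
  essential_of_first x hx := by
    obtain ⟨k, hk⟩ := exists_wordLevel_eq_succ P σ x
    cases k with
    | zero => exact Or.inl hk
    | succ k =>
      obtain ⟨y, hy, hyx⟩ :=
        exists_strictRel_of_symm_eq_levelEnd hσ (symm_eq_levelEnd_of_first hk hx)
      exact Or.inr ⟨y, by rw [hy, hk], hyx⟩

lemma IsWordLevel.wordLevel_eq (h : IsWordLevel P σ ℓ) : wordLevel P σ = ℓ :=
  (isWordLevel_wordLevel h.symm_lt_symm).unique h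

end Word

end Levels

section FundamentalBijection

variable {n : ℕ} {τ τ' σ : Perm (Fin n)} {x y : Fin n}

/-! ### Cycle words -/

lemma minimalPeriod_pos (τ : Perm (Fin n)) (x : Fin n) : 0 < Function.minimalPeriod τ x :=
  Function.minimalPeriod_pos_of_mem_periodicPts (τ.injective.mem_periodicPts x)

lemma mem_cycleWord : y ∈ cycleWord τ x ↔ τ.SameCycle x y := by
  rw [cycleWord, List.mem_iterate]
  constructor
  · rintro ⟨m, -, rfl⟩
    exact ⟨m, by rw [zpow_natCast, Perm.iterate_eq_pow]⟩
  · intro h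
    obtain ⟨m, hm⟩ := h.exists_nat_pow_eq
    refine ⟨m % Function.minimalPeriod τ x, Nat.mod_lt _ (minimalPeriod_pos τ x), ?_⟩
    rw [Function.iterate_mod_minimalPeriod_eq, Perm.iterate_eq_pow, hm]

lemma nodup_cycleWord (τ : Perm (Fin n)) (x : Fin n) : (cycleWord τ x).Nodup := by
  rw [List.nodup_iff_injective_getElem]
  rintro ⟨i, hi⟩ ⟨j, hj⟩ h
  simp only [cycleWord, List.getElem_iterate, List.length_iterate] at h hi hj
  exact Fin.ext (Function.iterate_injOn_Iio_minimalPeriod (Set.mem_Iio.2 hi) (Set.mem_Iio.2 hj) h)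

lemma exists_cycleWord_eq_cons (τ : Perm (Fin n)) (x : Fin n) : ∃ t, cycleWord τ x = x :: t := by
  obtain ⟨m, hm⟩ := Nat.exists_eq_add_of_le' (minimalPeriod_pos τ x)
  exact ⟨_, by rw [cycleWord, hm, List.iterate]⟩

lemma iterate_eq_of_cycleWord_eq (h : cycleWord τ x = cycleWord τ' x) (k : ℕ) :
    τ^[k] x = τ'^[k] x := by
  have hp : Function.minimalPeriod τ x = Function.minimalPeriod τ' x := by
    simpa only [cycleWord, List.length_iterate] using congrArg List.length h
  have hk := Nat.mod_lt k (minimalPeriod_pos τ x)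
  rw [← Function.iterate_mod_minimalPeriod_eq (f := τ),
    ← Function.iterate_mod_minimalPeriod_eq (f := τ'), ← hp]
  simpa only [cycleWord, List.getElem_iterate] using
    List.getElem_of_eq h (i := k % Function.minimalPeriod τ x)
      (by simpa only [cycleWord, List.length_iterate] using hk)

lemma apply_eq_of_cycleWord_eq (h : cycleWord τ x = cycleWord τ' x) (hxy : τ.SameCycle x y) :
    τ y = τ' y := by
  obtain ⟨k, rfl⟩ := hxy.exists_nat_pow_eq
  have hsucc := iterate_eq_of_cycleWord_eq h (k + 1)
  rwa [Function.iterate_succ_apply', Function.iterate_succ_apply',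
    ← iterate_eq_of_cycleWord_eq h k, Perm.iterate_eq_pow] at hsucc

lemma length_cycleWord_congr (h : ∀ y, τ.SameCycle x y ↔ τ'.SameCycle x y) :
    (cycleWord τ x).length = (cycleWord τ' x).length :=
  ((List.perm_ext_iff_of_nodup (nodup_cycleWord τ x) (nodup_cycleWord τ' x)).2 fun y => by
    rw [mem_cycleWord, mem_cycleWord, h]).length_eq

/-! ### The fundamental bijection for an injective weight -/

variable {W : Type*} [LinearOrder W] {w : Fin n ↪ W}

lemma exists_sameCycle_forall_le (w : Fin n ↪ W) (τ : Perm (Fin n)) (x : Fin n) :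
    ∃ h, τ.SameCycle x h ∧ ∀ y, τ.SameCycle x y → w y ≤ w h := by
  simpa only [mem_filter, mem_univ, true_and] using
    exists_max_image {y | τ.SameCycle x y} w ⟨x, by simp [Perm.SameCycle.refl]⟩

/-- The element of largest weight in the cycle of `τ` through `x`. -/
noncomputable def cycleHead (w : Fin n ↪ W) (τ : Perm (Fin n)) (x : Fin n) : Fin n :=
  (exists_sameCycle_forall_le w τ x).choose

lemma sameCycle_cycleHead (w : Fin n ↪ W) (τ : Perm (Fin n)) (x : Fin n) :
    τ.SameCycle x (cycleHead w τ x) :=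
  (exists_sameCycle_forall_le w τ x).choose_spec.1

lemma le_cycleHead (w : Fin n ↪ W) (h : τ.SameCycle x y) : w y ≤ w (cycleHead w τ x) :=
  (exists_sameCycle_forall_le w τ x).choose_spec.2 y h

lemma cycleHead_eq_cycleHead_iff :
    cycleHead w τ x = cycleHead w τ y ↔ τ.SameCycle x y := by
  refine ⟨fun h => ?_, fun h => w.injective (le_antisymm ?_ ?_)⟩
  · exact (sameCycle_cycleHead w τ x).trans (h ▸ (sameCycle_cycleHead w τ y).symm)
  · exact le_cycleHead w (h.symm.trans (sameCycle_cycleHead w τ x))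
  · exact le_cycleHead w (h.trans (sameCycle_cycleHead w τ y))

lemma cycleHead_cycleHead (w : Fin n ↪ W) (τ : Perm (Fin n)) (x : Fin n) :
    cycleHead w τ (cycleHead w τ x) = cycleHead w τ x :=
  cycleHead_eq_cycleHead_iff.2 (sameCycle_cycleHead w τ x).symm

lemma cycleHead_eq_self_iff : cycleHead w τ x = x ↔ ∀ y, τ.SameCycle x y → w y ≤ w x := by
  refine ⟨fun h y hy => h ▸ le_cycleHead w hy, fun h => w.injective (le_antisymm ?_ ?_)⟩
  exacts [h _ (sameCycle_cycleHead w τ x), le_cycleHead w (.refl _ _)]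

/-- The elements of largest weight of the cycles of `τ`, by increasing weight. -/
noncomputable def headList (w : Fin n ↪ W) (τ : Perm (Fin n)) : List (Fin n) :=
  ({x | cycleHead w τ x = x} : Finset (Fin n)).toList.mergeSort fun x y => w x ≤ w y

lemma mem_headList : x ∈ headList w τ ↔ cycleHead w τ x = x := by
  simp [headList]

lemma pairwise_headList (w : Fin n ↪ W) (τ : Perm (Fin n)) :
    (headList w τ).Pairwise fun x y => w x < w y := by
  have hle : (headList w τ).Pairwise fun x y => w x ≤ w y := by
    simpa only [headList, decide_eq_true_eq] using List.pairwise_mergeSort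
      (le := fun x y => w x ≤ w y)
      (fun a b c hab hbc => by simp only [decide_eq_true_eq] at *; exact hab.trans hbc)
      (fun a b => by simpa only [Bool.or_eq_true, decide_eq_true_eq] using le_total (w a) (w b)) _
  have hnodup : (headList w τ).Nodup := (List.mergeSort_perm _ _).nodup_iff.2 (nodup_toList _)
  exact (hle.and hnodup).imp fun h => h.1.lt_of_ne (w.injective.ne h.2)

lemma eq_headList_iff {xs : List (Fin n)} : xs = headList w τ ↔
    (∀ x, x ∈ xs ↔ cycleHead w τ x = x) ∧ xs.Pairwise fun x y => w x < w y := by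
  refine ⟨?_, fun ⟨hmem, hlt⟩ => ?_⟩
  · rintro rfl
    exact ⟨fun _ => mem_headList, pairwise_headList w τ⟩
  have nodup {l : List (Fin n)} (h : l.Pairwise fun x y => w x < w y) : l.Nodup :=
    h.imp fun h e => h.ne (congrArg w e)
  refine List.Perm.eq_of_pairwise (fun a b _ _ h h' => absurd h h'.asymm) hlt
    (pairwise_headList w τ) ?_
  exact (List.perm_ext_iff_of_nodup (nodup hlt) (nodup (pairwise_headList w τ))).2
    fun x => (hmem x).trans mem_headList.symm

lemma pairwise_eraseParentheses_headList {R : Fin n → Fin n → Prop}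
    (within : ∀ x, cycleHead w τ x = x → (cycleWord τ x).Pairwise R)
    (across : ∀ a b, w (cycleHead w τ a) < w (cycleHead w τ b) → R a b) :
    (eraseParentheses τ (headList w τ)).Pairwise R := by
  have head_eq {x a : Fin n} (hx : x ∈ headList w τ) (ha : a ∈ cycleWord τ x) :
      cycleHead w τ a = x :=
    (cycleHead_eq_cycleHead_iff.2 (mem_cycleWord.1 ha).symm).trans (mem_headList.1 hx)
  rw [eraseParentheses, List.pairwise_flatten, List.pairwise_map, List.forall_mem_map]
  refine ⟨fun x hx => within x (mem_headList.1 hx), ?_⟩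
  refine (pairwise_headList w τ).imp_of_mem fun hx hy hxy a ha b hb => across a b ?_
  rwa [head_eq hx ha, head_eq hy hb]

lemma nodup_eraseParentheses_headList (w : Fin n ↪ W) (τ : Perm (Fin n)) :
    (eraseParentheses τ (headList w τ)).Nodup :=
  pairwise_eraseParentheses_headList (fun x _ => nodup_cycleWord τ x)
    fun _ _ h e => h.ne (congrArg (fun x => w (cycleHead w τ x)) e)

lemma mem_eraseParentheses_headList (w : Fin n ↪ W) (τ : Perm (Fin n)) (x : Fin n) :
    x ∈ eraseParentheses τ (headList w τ) :=
  List.mem_flatten.2 ⟨_, List.mem_map_of_mem (mem_headList.2 (cycleHead_cycleHead w τ x)),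
    mem_cycleWord.2 (sameCycle_cycleHead w τ x).symm⟩

lemma exists_perm_ofFn_eq {l : List (Fin n)} (hnodup : l.Nodup) (hmem : ∀ x, x ∈ l) :
    ∃ σ : Perm (Fin n), List.ofFn σ = l := by
  let e := hnodup.getEquivOfForallMemList l hmem
  have hlen : l.length = n := by simpa using Fintype.card_congr e
  exact ⟨(finCongr hlen.symm).trans e, List.ext_getElem (by simp [hlen]) (by simp [e])⟩

lemma pairwise_ofFn_perm {R : Fin n → Fin n → Prop} :
    (List.ofFn σ).Pairwise R ↔ ∀ a b, σ.symm a < σ.symm b → R a b := by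
  rw [List.pairwise_ofFn]
  exact ⟨fun h a b hab => by simpa using h hab, fun h i j hij => h _ _ (by simpa using hij)⟩

/-- The image of `τ` under the fundamental bijection for the weight `w`: write each cycle with its
element of largest weight first, list the cycles by increasing largest weight and erase the
parentheses. -/
noncomputable def foata (w : Fin n ↪ W) (τ : Perm (Fin n)) : Perm (Fin n) :=
  (exists_perm_ofFn_eq (nodup_eraseParentheses_headList w τ)
    (mem_eraseParentheses_headList w τ)).choose

lemma ofFn_foata (w : Fin n ↪ W) (τ : Perm (Fin n)) :
    List.ofFn (foata w τ) = eraseParentheses τ (headList w τ) :=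
  (exists_perm_ofFn_eq (nodup_eraseParentheses_headList w τ)
    (mem_eraseParentheses_headList w τ)).choose_spec

lemma weight_cycleHead_mono (h : (foata w τ).symm x ≤ (foata w τ).symm y) :
    w (cycleHead w τ x) ≤ w (cycleHead w τ y) := by
  have hlt : ∀ a b, (foata w τ).symm a < (foata w τ).symm b →
      w (cycleHead w τ a) ≤ w (cycleHead w τ b) := by
    rw [← pairwise_ofFn_perm, ofFn_foata]
    refine pairwise_eraseParentheses_headList (fun x _ => ?_) fun _ _ => le_of_lt
    refine List.pairwise_of_forall_mem_list fun a ha b hb => le_of_eq (congrArg w ?_)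
    exact cycleHead_eq_cycleHead_iff.2 ((mem_cycleWord.1 ha).symm.trans (mem_cycleWord.1 hb))
  rcases h.lt_or_eq with h | h
  exacts [hlt x y h, by rw [(foata w τ).symm.injective h]]

lemma foata_symm_cycleHead_le (w : Fin n ↪ W) (τ : Perm (Fin n)) (x : Fin n) :
    (foata w τ).symm (cycleHead w τ x) ≤ (foata w τ).symm x := by
  have hne : ∀ a b, (foata w τ).symm a < (foata w τ).symm b → cycleHead w τ a ≠ b := by
    rw [← pairwise_ofFn_perm, ofFn_foata]
    refine pairwise_eraseParentheses_headList (fun x hx => ?_) ?_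
    · obtain ⟨t, ht⟩ := exists_cycleWord_eq_cons τ x
      have hxt : x ∉ t := (List.nodup_cons.1 (ht ▸ nodup_cycleWord τ x)).1
      have head_eq {a : Fin n} (ha : a ∈ x :: t) : cycleHead w τ a = x :=
        (cycleHead_eq_cycleHead_iff.2 (mem_cycleWord.1 (ht ▸ ha)).symm).trans hx
      rw [ht, List.pairwise_cons]
      refine ⟨fun b hb e => hxt ?_, List.pairwise_of_forall_mem_list fun a ha b hb e => hxt ?_⟩
      · rwa [← head_eq List.mem_cons_self, e]
      · rwa [← head_eq (List.mem_cons_of_mem _ ha), e]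
    · rintro a _ hab rfl
      exact hab.ne (by rw [cycleHead_cycleHead])
  exact not_lt.1 fun h => hne _ _ h rfl

/-- `x` is a left-to-right maximum of the word `σ` with respect to the weight `w`. -/
def IsRecord (w : Fin n ↪ W) (σ : Perm (Fin n)) (x : Fin n) : Prop :=
  ∀ y, σ.symm y < σ.symm x → w y < w x

lemma isRecord_foata_iff : IsRecord w (foata w τ) x ↔ cycleHead w τ x = x := by
  refine ⟨fun hx => ?_, fun hx y hy => ?_⟩
  · refine (foata w τ).symm.injective ((foata_symm_cycleHead_le w τ x).eq_of_not_lt fun hlt => ?_)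
    exact (le_cycleHead w (.refl _ _)).not_gt (hx _ hlt)
  · have hyx := (le_cycleHead w (.refl _ y)).trans (weight_cycleHead_mono hy.le)
    rw [hx] at hyx
    exact hyx.lt_of_ne (w.injective.ne fun e => (e ▸ hy).false)

lemma cyc_eq_ncard_isRecord (w : Fin n ↪ W) (τ : Perm (Fin n)) :
    cyc τ = Set.ncard {x | IsRecord w (foata w τ) x} := by
  let toCycle (x : {x | IsRecord w (foata w τ) x}) := Quotient.mk (cyclePartition τ) x.1
  rw [← Nat.card_coe_set_eq]
  refine (Nat.card_eq_of_bijective toCycle ⟨fun x y h => ?_, ?_⟩).symm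
  · have hhead := cycleHead_eq_cycleHead_iff (w := w).2 (Quotient.exact h)
    rwa [isRecord_foata_iff.1 x.2, isRecord_foata_iff.1 y.2, ← Subtype.ext_iff] at hhead
  · rintro ⟨b⟩
    exact ⟨⟨cycleHead w τ b, isRecord_foata_iff.2 (cycleHead_cycleHead w τ b)⟩,
      Quotient.sound (sameCycle_cycleHead w τ b).symm⟩

-- The head of the cycle through `x` is the last record of the word at or before `x`.
lemma cycleHead_eq_of_foata_eq (h : foata w τ = foata w τ') : cycleHead w τ = cycleHead w τ' := by
  have weight_le {τ τ' : Perm (Fin n)} (h : foata w τ = foata w τ') (x : Fin n) :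
      w (cycleHead w τ' x) ≤ w (cycleHead w τ x) := by
    have hhead : cycleHead w τ (cycleHead w τ' x) = cycleHead w τ' x := by
      rw [← isRecord_foata_iff, h, isRecord_foata_iff, cycleHead_cycleHead]
    rw [← hhead]
    exact weight_cycleHead_mono (h ▸ foata_symm_cycleHead_le w τ' x)
  exact funext fun x => w.injective (le_antisymm (weight_le h.symm x) (weight_le h x))

lemma foata_injective (w : Fin n ↪ W) : Function.Injective (foata w) := by
  intro τ τ' h
  have hhead := cycleHead_eq_of_foata_eq h
  have hlist : headList w τ = headList w τ' := by simp only [headList, hhead]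
  have hcycle (x y : Fin n) : τ.SameCycle x y ↔ τ'.SameCycle x y := by
    rw [← cycleHead_eq_cycleHead_iff (w := w), hhead, cycleHead_eq_cycleHead_iff]
  have hwords : (headList w τ).map (cycleWord τ) = (headList w τ).map (cycleWord τ') := by
    refine List.eq_iff_flatten_eq.2 ⟨?_, ?_⟩
    · have hword := ofFn_foata w τ'
      rwa [← h, ofFn_foata, ← hlist] at hword
    · simp only [List.map_map, Function.comp_def, length_cycleWord_congr (hcycle _)]
  ext1 x
  exact apply_eq_of_cycleWord_eq
    (List.map_inj_left.1 hwords _ (mem_headList.2 (cycleHead_cycleHead w τ x)))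
    (sameCycle_cycleHead w τ x).symm

lemma foata_bijective (w : Fin n ↪ W) : Function.Bijective (foata w) :=
  Finite.injective_iff_bijective.1 (foata_injective w)

end FundamentalBijection

section StandardForm

variable {n : ℕ} {P : Fin n → Fin n → Prop} {ℓ : Fin n → ℕ} {τ σ : Perm (Fin n)} {x y : Fin n}

/-! ### The weight attached to a level function -/

open scoped Classical in
/-- The weight whose fundamental bijection produces the standard forms: elements are compared by
level; within a level the essential elements come last; ties are broken by the order of the
integers. -/
noncomputable def weight (P : Fin n → Fin n → Prop) (ℓ : Fin n → ℕ) :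
    Fin n ↪ ℕ ×ₗ Bool ×ₗ Fin n where
  toFun x := toLex (ℓ x, toLex (decide (Essential P ℓ x), x))
  inj' x y h := by
    simp only [EmbeddingLike.apply_eq_iff_eq, Prod.mk.injEq] at h
    exact h.2.2

lemma weight_lt_weight_iff : weight P ℓ x < weight P ℓ y ↔ ℓ x < ℓ y ∨ ℓ x = ℓ y ∧
    (¬ Essential P ℓ x ∧ Essential P ℓ y ∨ (Essential P ℓ x ↔ Essential P ℓ y) ∧ x < y) := by
  change toLex (ℓ x, toLex (_, x)) < toLex (ℓ y, toLex (_, y)) ↔ _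
  simp only [Prod.Lex.toLex_lt_toLex, Bool.lt_iff, decide_eq_true_eq, decide_eq_false_iff_not,
    decide_eq_decide]

lemma level_le_of_weight_le (h : weight P ℓ x ≤ weight P ℓ y) : ℓ x ≤ ℓ y :=
  not_lt.1 fun hlt => h.not_gt (weight_lt_weight_iff.2 (Or.inl hlt))

lemma weight_lt_of_not_essential (hlevel : ℓ x = ℓ y) (hx : ¬ Essential P ℓ x)
    (hy : Essential P ℓ y) : weight P ℓ x < weight P ℓ y :=
  weight_lt_weight_iff.2 (Or.inr ⟨hlevel, Or.inl ⟨hx, hy⟩⟩)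

lemma weight_lt_iff_of_essential (hx : Essential P ℓ x) (hy : Essential P ℓ y) :
    weight P ℓ x < weight P ℓ y ↔ ℓ x < ℓ y ∨ ℓ x = ℓ y ∧ x < y := by
  simp only [weight_lt_weight_iff, hx, hy, not_true, false_and, iff_self, true_and, false_or]

lemma weight_le_iff_of_essential (hlevel : ℓ x = ℓ y) (hx : Essential P ℓ x)
    (hy : Essential P ℓ y) : weight P ℓ x ≤ weight P ℓ y ↔ x ≤ y := by
  rw [← not_lt, weight_lt_iff_of_essential hy hx]
  simp only [hlevel, lt_irrefl, true_and, false_or, not_lt]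

lemma essential_of_weight_le (hlevel : ℓ x = ℓ y) (hx : Essential P ℓ x)
    (hle : weight P ℓ x ≤ weight P ℓ y) : Essential P ℓ y :=
  by_contra fun hy => hle.not_gt (weight_lt_of_not_essential hlevel.symm hy hx)

/-! ### Levels under the fundamental bijection -/

lemma IsBlockLevel.level_cycleHead {W : Type*} [LinearOrder W]
    (h : IsBlockLevel P (cyclePartition τ) ℓ) (w : Fin n ↪ W) (x : Fin n) :
    ℓ (cycleHead w τ x) = ℓ x :=
  (h.const _ _ (sameCycle_cycleHead w τ x)).symm

lemma IsBlockLevel.essential_cycleHead (h : IsBlockLevel P (cyclePartition τ) ℓ) (x : Fin n) :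
    Essential P ℓ (cycleHead (weight P ℓ) τ x) := by
  obtain ⟨y, hxy, hy⟩ := h.exists_essential x
  exact essential_of_weight_le ((h.const _ _ hxy).symm.trans (h.level_cycleHead _ x).symm) hy
    (le_cycleHead _ hxy)

lemma IsBlockLevel.isWordLevel_foata (h : IsBlockLevel P (cyclePartition τ) ℓ) :
    IsWordLevel P (foata (weight P ℓ) τ) ℓ where
  strict := h.strict
  mono x y hxy := by
    rw [← h.level_cycleHead (weight P ℓ) x, ← h.level_cycleHead (weight P ℓ) y]
    exact level_le_of_weight_le (weight_cycleHead_mono hxy)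
  essential_of_first x hx := by
    rcases (foata_symm_cycleHead_le (weight P ℓ) τ x).lt_or_eq with hlt | heq
    · exact absurd (h.level_cycleHead _ x) (hx _ hlt).ne
    · exact (foata (weight P ℓ) τ).symm.injective heq ▸ h.essential_cycleHead x

lemma IsWordLevel.essential_of_isRecord (h : IsWordLevel P σ ℓ)
    (hx : IsRecord (weight P ℓ) σ x) : Essential P ℓ x := by
  obtain ⟨y, hy, hlevel, hyx⟩ := h.exists_essential_le x
  rcases hyx.lt_or_eq with hlt | heq
  · exact essential_of_weight_le hlevel hy (hx y hlt).le
  · exact σ.symm.injective heq ▸ hy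

lemma IsWordLevel.isBlockLevel (h : IsWordLevel P (foata (weight P ℓ) τ) ℓ) :
    IsBlockLevel P (cyclePartition τ) ℓ := by
  have level_cycleHead (x : Fin n) : ℓ (cycleHead (weight P ℓ) τ x) = ℓ x :=
    le_antisymm (h.mono _ _ (foata_symm_cycleHead_le _ τ x))
      (level_le_of_weight_le (le_cycleHead _ (.refl τ x)))
  refine ⟨h.strict, fun x y hxy => ?_, fun x => ⟨_, sameCycle_cycleHead (weight P ℓ) τ x, ?_⟩⟩
  · rw [← level_cycleHead x, cycleHead_eq_cycleHead_iff.2 hxy, level_cycleHead]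
  · exact h.essential_of_isRecord (isRecord_foata_iff.2 (cycleHead_cycleHead _ τ x))

lemma IsWordLevel.isPLRMax_iff (h : IsWordLevel P σ ℓ) :
    IsPLRMax P σ x ↔ IsRecord (weight P ℓ) σ x := by
  rw [IsPLRMax, h.wordLevel_eq]
  refine ⟨fun ⟨hx, hmax⟩ y hy => ?_,
    fun hx => ⟨h.essential_of_isRecord hx, fun y hy hlevel hyx => ?_⟩⟩
  · rcases (h.mono y x hy.le).lt_or_eq with hlt | hlevel
    · exact weight_lt_weight_iff.2 (Or.inl hlt)
    by_cases hye : Essential P ℓ y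
    · have hne : y ≠ x := fun e => (e ▸ hy).false
      exact (weight_lt_iff_of_essential hye hx).2
        (Or.inr ⟨hlevel, (hmax y hye hlevel hy.le).lt_of_ne hne⟩)
    · exact weight_lt_of_not_essential hlevel hye hx
  · rcases hyx.lt_or_eq with hlt | heq
    · exact (weight_le_iff_of_essential hlevel hy (h.essential_of_isRecord hx)).1 (hx y hlt).le
    · exact (σ.symm.injective heq).le

/-! ### Standard forms -/

lemma IsBlockLevel.eq_headList (h : IsBlockLevel P (cyclePartition τ) ℓ) {xs : List (Fin n)}
    (hxs : IsStandardForm P τ xs) : xs = headList (weight P ℓ) τ := by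
  obtain ⟨hcyc, hess, hmax, hsort⟩ := hxs
  rw [h.permLevel_eq] at hess hmax hsort
  have hhead {x : Fin n} (hx : x ∈ xs) : cycleHead (weight P ℓ) τ x = x := by
    have hx_ess := hess x hx
    refine (weight P ℓ).injective (le_antisymm ?_ (le_cycleHead _ (.refl τ x)))
    exact (weight_le_iff_of_essential (h.level_cycleHead _ x) (h.essential_cycleHead x) hx_ess).2
      (hmax x hx _ (sameCycle_cycleHead _ τ x) (h.essential_cycleHead x))
  refine eq_headList_iff.2 ⟨fun x => ⟨hhead, fun hx => ?_⟩, ?_⟩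
  · obtain ⟨y, ⟨hy, hyx⟩, -⟩ := hcyc x
    rwa [← hx, ← cycleHead_eq_cycleHead_iff.2 hyx, hhead hy]
  · exact hsort.imp_of_mem fun hx hy hxy =>
      (weight_lt_iff_of_essential (hess _ hx) (hess _ hy)).2 hxy

lemma IsBlockLevel.isStandardForm_headList (h : IsBlockLevel P (cyclePartition τ) ℓ) :
    IsStandardForm P τ (headList (weight P ℓ) τ) := by
  have hess {x : Fin n} (hx : x ∈ headList (weight P ℓ) τ) : Essential P ℓ x :=
    mem_headList.1 hx ▸ h.essential_cycleHead x
  refine ⟨fun y => ⟨cycleHead (weight P ℓ) τ y, ⟨?_, ?_⟩, ?_⟩, ?_, ?_, ?_⟩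
  · exact mem_headList.2 (cycleHead_cycleHead _ τ y)
  · exact (sameCycle_cycleHead _ τ y).symm
  · rintro x ⟨hx, hxy⟩
    rw [← mem_headList.1 hx, cycleHead_eq_cycleHead_iff.2 hxy]
  all_goals rw [h.permLevel_eq]
  · exact fun x => hess
  · exact fun x hx y hxy hy => (weight_le_iff_of_essential (h.const _ _ hxy).symm hy (hess hx)).1
      (cycleHead_eq_self_iff.1 (mem_headList.1 hx) y hxy)
  · exact (pairwise_headList (weight P ℓ) τ).imp_of_mem fun hx hy hxy =>
      (weight_lt_iff_of_essential (hess hx) (hess hy)).1 hxy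

lemma IsBlockLevel.isStandardForm_iff (h : IsBlockLevel P (cyclePartition τ) ℓ)
    {xs : List (Fin n)} : IsStandardForm P τ xs ↔ xs = headList (weight P ℓ) τ :=
  ⟨h.eq_headList, fun hxs => hxs ▸ h.isStandardForm_headList⟩

lemma mem_transversePerms : τ ∈ transversePerms P ↔ IsTransverse P (cyclePartition τ) := by
  simp [transversePerms]

lemma mem_linearExtensions :
    σ ∈ linearExtensions P ↔ ∀ i j, StrictRel P i j → σ.symm i < σ.symm j := by
  simp [linearExtensions]

lemma isBlockLevel_of_mem_transversePerms (hτ : τ ∈ transversePerms P) :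
    IsBlockLevel P (cyclePartition τ) (permLevel P τ) :=
  (mem_transversePerms.1 hτ).isBlockLevel_permLevel

lemma existsUnique_isStandardForm (hτ : τ ∈ transversePerms P) :
    ∃! xs, IsStandardForm P τ xs := by
  simp only [(isBlockLevel_of_mem_transversePerms hτ).isStandardForm_iff, existsUnique_eq]

/-- The word `Φ(τ)` read off the standard form of a transverse permutation `τ`. -/
noncomputable def standardWord (P : Fin n → Fin n → Prop) (τ : Perm (Fin n)) : Perm (Fin n) :=
  foata (weight P (permLevel P τ)) τ

lemma isWordLevel_standardWord (hτ : τ ∈ transversePerms P) :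
    IsWordLevel P (standardWord P τ) (permLevel P τ) :=
  (isBlockLevel_of_mem_transversePerms hτ).isWordLevel_foata

lemma ofFn_standardWord {xs : List (Fin n)} (hτ : τ ∈ transversePerms P)
    (hxs : IsStandardForm P τ xs) : List.ofFn (standardWord P τ) = eraseParentheses τ xs := by
  rw [(isBlockLevel_of_mem_transversePerms hτ).isStandardForm_iff.1 hxs, standardWord, ofFn_foata]

lemma cyc_eq_PLRmax_standardWord (hτ : τ ∈ transversePerms P) :
    cyc τ = PLRmax P (standardWord P τ) := by
  simp only [PLRmax, (isWordLevel_standardWord hτ).isPLRMax_iff]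
  exact cyc_eq_ncard_isRecord _ τ

lemma bijOn_standardWord (P : Fin n → Fin n → Prop) :
    Set.BijOn (standardWord P) (transversePerms P) (linearExtensions P) := by
  refine ⟨fun τ hτ => ?_, fun τ hτ τ' hτ' h => ?_, fun σ hσ => ?_⟩
  · exact mem_linearExtensions.2 (isWordLevel_standardWord hτ).symm_lt_symm
  · have hlevel : permLevel P τ = permLevel P τ' :=
      (isWordLevel_standardWord hτ).unique (h ▸ isWordLevel_standardWord hτ')
    rw [standardWord, standardWord, ← hlevel] at h
    exact foata_injective (weight P (permLevel P τ)) h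
  · have hword := isWordLevel_wordLevel (mem_linearExtensions.1 hσ)
    obtain ⟨τ, hτ⟩ := (foata_bijective (weight P (wordLevel P σ))).surjective σ
    have hblock : IsBlockLevel P (cyclePartition τ) (wordLevel P σ) :=
      IsWordLevel.isBlockLevel (by rwa [hτ])
    refine ⟨τ, mem_transversePerms.2 hblock.isTransverse, ?_⟩
    rw [standardWord, hblock.permLevel_eq, hτ]

/-! ### Antichains -/

lemma isBlockLevel_one (hP : ∀ i j, ¬ StrictRel P i j) (π : Setoid (Fin n)) :
    IsBlockLevel P π fun _ => 1 :=
  ⟨fun p q h => absurd h (hP p q), fun _ _ _ => rfl, fun x => ⟨x, π.refl x, Or.inl rfl⟩⟩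

lemma isWordLevel_one (hP : ∀ i j, ¬ StrictRel P i j) (σ : Perm (Fin n)) :
    IsWordLevel P σ fun _ => 1 :=
  ⟨fun p q h => absurd h (hP p q), fun _ _ _ => le_rfl, fun _ _ => Or.inl rfl⟩

lemma mem_transversePerms_of_antichain (hP : ∀ i j, ¬ StrictRel P i j) (τ : Perm (Fin n)) :
    τ ∈ transversePerms P :=
  mem_transversePerms.2 (isBlockLevel_one hP _).isTransverse

lemma mem_linearExtensions_of_antichain (hP : ∀ i j, ¬ StrictRel P i j) (σ : Perm (Fin n)) :
    σ ∈ linearExtensions P :=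
  mem_linearExtensions.2 (isWordLevel_one hP σ).symm_lt_symm

lemma PLRmax_eq_LRmax (hP : ∀ i j, ¬ StrictRel P i j) (σ : Perm (Fin n)) :
    PLRmax P σ = LRmax σ := by
  simp [PLRmax, LRmax, IsPLRMax, (isWordLevel_one hP σ).wordLevel_eq, Essential]

lemma ofFn_standardWord_of_antichain (hP : ∀ i j, ¬ StrictRel P i j) (τ : Perm (Fin n)) :
    List.ofFn (standardWord P τ) = fundamentalWord τ := by
  classical
  have hess (x : Fin n) : Essential P (fun _ => 1) x := Or.inl rfl
  have weight_le (x y : Fin n) : weight P (fun _ => 1) x ≤ weight P (fun _ => 1) y ↔ x ≤ y :=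
    weight_le_iff_of_essential rfl (hess x) (hess y)
  refine ofFn_standardWord (mem_transversePerms_of_antichain hP τ) ?_
  refine (isBlockLevel_one hP _).isStandardForm_iff.2 (eq_headList_iff.2 ⟨fun x => ?_, ?_⟩)
  · simp only [mem_sort, mem_filter, mem_univ, true_and, cycleHead_eq_self_iff, weight_le]
  · exact (sortedLT_sort _).pairwise.imp fun h =>
      (weight_lt_iff_of_essential (hess _) (hess _)).2 (Or.inr ⟨rfl, h⟩)

end StandardForm

open Polynomial

/-! ### Intersection posets -/

section Arrangement

variable {V : Type*} [AddCommGroup V] [Module ℝ V]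

instance (A : Finset (Submodule ℝ V)) : OrderBot (IntersectionPoset A) where
  bot := .whole A
  bot_le X := show X.subspace ≤ ⊤ from le_top

lemma IntersectionPoset.exists_subspace_le {A : Finset (Submodule ℝ V)} {X : IntersectionPoset A}
    (hX : X ≠ ⊥) : ∃ H ∈ A, X.subspace ≤ H := by
  obtain ⟨S, hS, hSX⟩ := mem_image.1 X.2
  rcases S.eq_empty_or_nonempty with rfl | ⟨H, hH⟩
  · exact absurd (Subtype.ext hSX.symm) hX
  · refine ⟨H, mem_powerset.1 hS hH, ?_⟩
    rw [IntersectionPoset.subspace, ← hSX]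
    exact inf_le (f := id) hH

open scoped Classical in
lemma poincare_eq_sum [FiniteDimensional ℝ V] (A : Finset (Submodule ℝ V)) (K : Set V) :
    poincare A K = ∑ X : IntersectionPoset A with ((X.subspace : Set V) ∩ K).Nonempty,
      (moebius A X).natAbs • (Polynomial.X : ℕ[X]) ^ Module.finrank ℝ (V ⧸ X.subspace) := by
  have codim_mem (X : IntersectionPoset A) :
      Module.finrank ℝ (V ⧸ X.subspace) ∈ range (Module.finrank ℝ V + 1) :=
    mem_range.2 (Nat.lt_succ_of_le (Submodule.finrank_quotient_le _))
  rw [poincare, ← sum_fiberwise_of_maps_to fun X _ => codim_mem X]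
  refine sum_congr rfl fun k _ => ?_
  rw [whitney, map_sum, sum_mul, filter_filter]
  refine sum_congr rfl fun X hX => ?_
  rw [(mem_filter.1 hX).2.2, nsmul_eq_mul, ← C_eq_natCast, Nat.cast_id]

end Arrangement

/-! ### Signs of permutations -/

section Sign

variable {α : Type*} [Fintype α] [DecidableEq α]

lemma sum_sign_eq_zero_of_swap_mul_mem {s : Finset (Perm α)} {i j : α} (hij : i ≠ j)
    (hs : ∀ τ ∈ s, swap i j * τ ∈ s) : ∑ τ ∈ s, (Perm.sign τ : ℤ) = 0 := by
  refine sum_involution (fun τ _ => swap i j * τ) (fun τ _ => ?_) (fun τ _ _ h => ?_) hs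
    fun τ _ => swap_mul_self_mul i j τ
  · rw [Perm.sign_mul, Perm.sign_swap hij, neg_one_mul, Units.val_neg, add_neg_cancel]
  · exact hij (swap_eq_one_iff.1 (mul_eq_right.1 h))

lemma cycleFactorsFinset_eq_image_cycleOf (τ : Perm α) :
    τ.cycleFactorsFinset = τ.support.image τ.cycleOf := by
  ext c
  rw [mem_image]
  constructor
  · intro hc
    obtain ⟨x, hx⟩ := (Perm.mem_cycleFactorsFinset_iff.1 hc).1.nonempty_support
    exact ⟨x, Perm.mem_cycleFactorsFinset_support_le hc hx, (Perm.cycle_is_cycleOf hx hc).symm⟩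
  · rintro ⟨x, hx, rfl⟩
    exact Perm.cycleOf_mem_cycleFactorsFinset_iff.2 hx

lemma injOn_support_cycleFactorsFinset (τ : Perm α) :
    Set.InjOn Perm.support (τ.cycleFactorsFinset : Set (Perm α)) := by
  intro c hc d hd h
  by_contra hne
  obtain ⟨x, hx⟩ := (Perm.mem_cycleFactorsFinset_iff.1 hc).1.nonempty_support
  have hdisj := (τ.cycleFactorsFinset_pairwise_disjoint hc hd hne).disjoint_support
  exact Finset.disjoint_left.1 hdisj hx (h ▸ hx)

lemma cycleType_eq_map_card_image (τ : Perm α) :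
    τ.cycleType = (τ.support.image fun x => (τ.cycleOf x).support).val.map card := by
  rw [Perm.cycleType_def, ← Multiset.map_map, ← image_val_of_injOn
    (injOn_support_cycleFactorsFinset τ), cycleFactorsFinset_eq_image_cycleOf, image_image]
  rfl

lemma sign_eq_of_sameCycle_iff {σ τ : Perm α} (h : ∀ x y, σ.SameCycle x y ↔ τ.SameCycle x y) :
    Perm.sign σ = Perm.sign τ := by
  have mem_support (ρ : Perm α) (x : α) : x ∈ ρ.support ↔ ∃ y, y ≠ x ∧ ρ.SameCycle x y := by
    rw [Perm.mem_support]
    exact ⟨fun hx => ⟨ρ x, hx, Perm.sameCycle_apply_right.2 (.refl ρ x)⟩,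
      fun ⟨y, hyx, hxy⟩ hx => hyx (hxy.eq_of_left hx).symm⟩
  have hsupp : σ.support = τ.support := by
    ext x
    simp only [mem_support, h]
  have hcycle (x : α) : (σ.cycleOf x).support = (τ.cycleOf x).support := by
    ext y
    simp only [Perm.mem_support_cycleOf_iff, h, hsupp]
  rw [Perm.sign_of_cycleType, Perm.sign_of_cycleType, cycleType_eq_map_card_image,
    cycleType_eq_map_card_image, hsupp]
  simp only [hcycle]

end Sign

/-! ### The flats of the braid arrangement -/

section BlockSpace

variable {ι : Type*} {π : Setoid ι} {x : ι → ℝ}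

/-- The vectors that are constant on the blocks of the set partition `π`, that is, the functions
pulled back from the set of blocks. For `ι = [n]` these subspaces are the elements of the
intersection poset of the braid arrangement. -/
def blockSpace (π : Setoid ι) : Submodule ℝ (ι → ℝ) :=
  LinearMap.range (LinearMap.funLeft ℝ ℝ (Quotient.mk π))

lemma mem_blockSpace : x ∈ blockSpace π ↔ ∀ i j, π i j → x i = x j := by
  constructor
  · rintro ⟨y, rfl⟩ i j hij
    exact congrArg y (Quotient.sound hij)
  · exact fun h => ⟨Quotient.lift x h, rfl⟩

lemma blockSpace_injective : Function.Injective (blockSpace (ι := ι)) := by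
  classical
  have rel_iff (π : Setoid ι) (i j : ι) : π i j ↔ ∀ x ∈ blockSpace π, x i = x j := by
    refine ⟨fun hij x hx => mem_blockSpace.1 hx i j hij, fun h => ?_⟩
    have indicator_mem : (fun k => if π i k then (1 : ℝ) else 0) ∈ blockSpace π := by
      refine mem_blockSpace.2 fun k l hkl => ?_
      have : π i k ↔ π i l := ⟨fun hk => π.trans hk hkl, fun hl => π.trans hl (π.symm hkl)⟩
      simp only [this]
    by_contra hij
    simpa [hij, π.refl i] using h _ indicator_mem
  intro π π' h
  ext i j
  rw [rel_iff, rel_iff, h]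

lemma finrank_quotient_blockSpace [Finite ι] (π : Setoid ι) :
    Module.finrank ℝ ((ι → ℝ) ⧸ blockSpace π) = Nat.card ι - Nat.card (Quotient π) := by
  classical
  have := Fintype.ofFinite ι
  rw [Submodule.finrank_quotient, blockSpace, LinearMap.finrank_range_of_inj
    (LinearMap.funLeft_injective_of_surjective ℝ ℝ _ Quotient.mk_surjective),
    Module.finrank_fintype_fun_eq_card, Module.finrank_fintype_fun_eq_card,
    Nat.card_eq_fintype_card, Nat.card_eq_fintype_card]

lemma mem_blockSpace_sameCycle_iff [Finite ι] {τ : Perm ι} :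
    x ∈ blockSpace (Perm.SameCycle.setoid τ) ↔ ∀ i, x (τ i) = x i := by
  rw [mem_blockSpace]
  refine ⟨fun h i => h _ _ (Perm.sameCycle_apply_left.2 (.refl τ i)), fun h i j hij => ?_⟩
  obtain ⟨k, rfl⟩ := Perm.SameCycle.exists_nat_pow_eq hij
  have iterate_eq : ∀ k : ℕ, x ((τ ^ k) i) = x i := fun k => by
    induction k with
    | zero => rfl
    | succ k ih => rw [pow_succ', Perm.mul_apply, h, ih]
  exact (iterate_eq k).symm

end BlockSpace

section Braid

variable {n : ℕ} {P : Fin n → Fin n → Prop} {π : Setoid (Fin n)} {τ : Perm (Fin n)}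

lemma mem_braidHyperplane {i j : Fin n} {x : Fin n → ℝ} :
    x ∈ braidHyperplane i j ↔ x i = x j := Iff.rfl

lemma blockSpace_mem_intersections (π : Setoid (Fin n)) :
    OrderDual.toDual (blockSpace π) ∈ intersections (braidArrangement n) := by
  classical
  refine mem_image.2 ⟨(univ.filter fun p : Fin n × Fin n => p.1 < p.2 ∧ π p.1 p.2).image
    fun p => braidHyperplane p.1 p.2, mem_powerset.2 (image_subset_image fun p hp => ?_), ?_⟩
  · exact mem_filter.2 ⟨mem_univ p, (mem_filter.1 hp).2.1⟩
  congr 1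
  ext x
  simp only [inf_image, Submodule.mem_finsetInf, mem_filter, mem_univ, true_and,
    Function.comp_apply, id, mem_braidHyperplane, mem_blockSpace]
  refine ⟨fun h i j hij => ?_, fun h p hp => h _ _ hp.2⟩
  rcases lt_trichotomy i j with hlt | rfl | hlt
  · exact h (i, j) ⟨hlt, hij⟩
  · rfl
  · exact (h (j, i) ⟨hlt, π.symm hij⟩).symm

/-- The element of the intersection poset of the braid arrangement attached to the cycle partition
of `τ`: the space of vectors fixed by `τ`. -/
def fixedFlat (τ : Perm (Fin n)) : IntersectionPoset (braidArrangement n) :=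
  ⟨OrderDual.toDual (blockSpace (cyclePartition τ)), blockSpace_mem_intersections _⟩

lemma fixedFlat_le_iff {X : IntersectionPoset (braidArrangement n)} :
    fixedFlat τ ≤ X ↔ ∀ x ∈ X.subspace, ∀ i, x (τ i) = x i :=
  forall₂_congr fun _ _ => mem_blockSpace_sameCycle_iff

lemma sameCycle_iff_of_fixedFlat_eq {τ' : Perm (Fin n)} (h : fixedFlat τ = fixedFlat τ')
    (i j : Fin n) : τ.SameCycle i j ↔ τ'.SameCycle i j := by
  have : cyclePartition τ = cyclePartition τ' :=
    blockSpace_injective (congrArg IntersectionPoset.subspace h)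
  exact Setoid.ext_iff.1 this i j

lemma fixedFlat_eq_bot_iff : fixedFlat τ = ⊥ ↔ τ = 1 := by
  rw [← le_bot_iff, fixedFlat_le_iff]
  refine ⟨fun h => Equiv.ext fun i => Fin.ext ?_, fun h x _ i => by rw [h, Perm.one_apply]⟩
  exact_mod_cast h (fun j => (j : ℝ)) Submodule.mem_top i

open scoped Classical in
lemma sum_sign_fixedFlat_le (X : IntersectionPoset (braidArrangement n)) :
    ∑ τ : Perm (Fin n) with fixedFlat τ ≤ X, (Perm.sign τ : ℤ) = if X = ⊥ then 1 else 0 := by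
  split_ifs with hX
  · simp [hX, fixedFlat_eq_bot_iff, filter_eq']
  obtain ⟨H, hH, hXH⟩ := IntersectionPoset.exists_subspace_le hX
  obtain ⟨⟨i, j⟩, hij, rfl⟩ := mem_image.1 hH
  refine sum_sign_eq_zero_of_swap_mul_mem (mem_filter.1 hij).2.ne fun τ hτ => ?_
  simp only [mem_filter, mem_univ, true_and, fixedFlat_le_iff] at hτ ⊢
  intro x hx k
  have apply_swap (l : Fin n) : x (swap i j l) = x l := by
    rw [swap_apply_def]
    split_ifs with hi hj
    · rw [hi, mem_braidHyperplane.1 (hXH hx)]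
    · rw [hj, mem_braidHyperplane.1 (hXH hx)]
    · rfl
  rw [Perm.mul_apply, apply_swap, hτ x hx]

open scoped Classical in
lemma moebius_eq_sum_sign (X : IntersectionPoset (braidArrangement n)) :
    moebius (braidArrangement n) X =
      ∑ τ : Perm (Fin n) with fixedFlat τ = X, (Perm.sign τ : ℤ) := by
  have fiberwise (Y : IntersectionPoset (braidArrangement n)) :
      (if Y = ⊥ then 1 else 0 : ℤ) =
        ∑ Z ∈ Iic Y, ∑ τ : Perm (Fin n) with fixedFlat τ = Z, (Perm.sign τ : ℤ) := by
    rw [← sum_sign_fixedFlat_le, ← sum_fiberwise_of_maps_to (g := fixedFlat) (t := Iic Y)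
      fun τ hτ => mem_Iic.2 (mem_filter.1 hτ).2]
    refine sum_congr rfl fun Z hZ => sum_congr ?_ fun _ _ => rfl
    ext τ
    simp only [mem_filter, mem_univ, true_and, and_iff_right_iff_imp]
    rintro rfl
    exact mem_Iic.1 hZ
  rw [IncidenceAlgebra.moebius_inversion_bot _ _ fiberwise X]
  simp only [mul_ite, mul_one, mul_zero, sum_ite_eq', mem_Iic, bot_le, if_true]
  rfl

open scoped Classical in
lemma natAbs_moebius (X : IntersectionPoset (braidArrangement n)) :
    (moebius (braidArrangement n) X).natAbs = #{τ : Perm (Fin n) | fixedFlat τ = X} := by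
  rw [moebius_eq_sum_sign]
  rcases eq_empty_or_nonempty {τ : Perm (Fin n) | fixedFlat τ = X} with h | ⟨τ₀, hτ₀⟩
  · simp only [h, sum_empty, card_empty, Int.natAbs_zero]
  · have sign_eq : ∀ τ ∈ ({τ | fixedFlat τ = X} : Finset (Perm (Fin n))),
        (Perm.sign τ : ℤ) = Perm.sign τ₀ := fun τ hτ => by
      rw [sign_eq_of_sameCycle_iff (sameCycle_iff_of_fixedFlat_eq
        ((mem_filter.1 hτ).2.trans (mem_filter.1 hτ₀).2.symm))]
    rw [sum_congr rfl sign_eq, sum_const, nsmul_eq_mul, Int.natAbs_mul, Int.natAbs_natCast,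
      Int.units_natAbs, mul_one]

lemma blockSpace_inter_posetCone_nonempty_iff :
    ((blockSpace π : Set (Fin n → ℝ)) ∩ posetCone P).Nonempty ↔ IsTransverse P π := by
  constructor
  · rintro ⟨x, hx, hxP⟩
    exact isTransverse_of_strictMono (f := Quotient.lift x (mem_blockSpace.1 hx)) hxP
  · intro h
    obtain ⟨ℓ, hℓ⟩ := h.exists_isBlockLevel
    exact ⟨fun i => ℓ i, mem_blockSpace.2 fun i j hij => congrArg Nat.cast (hℓ.const i j hij),
      fun i j hij => Nat.cast_lt.2 (hℓ.strict i j hij)⟩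

lemma Poin_eq_sum_transversePerms (P : Fin n → Fin n → Prop) :
    Poin P = ∑ τ ∈ transversePerms P, (X : ℕ[X]) ^ (n - cyc τ) := by
  classical
  have meets_iff (τ : Perm (Fin n)) :
      (((fixedFlat τ).subspace : Set (Fin n → ℝ)) ∩ posetCone P).Nonempty ↔
        τ ∈ transversePerms P :=
    blockSpace_inter_posetCone_nonempty_iff.trans mem_transversePerms.symm
  have codim (τ : Perm (Fin n)) :
      Module.finrank ℝ ((Fin n → ℝ) ⧸ (fixedFlat τ).subspace) = n - cyc τ :=
    (finrank_quotient_blockSpace (cyclePartition τ)).trans (by rw [Nat.card_fin, cyc])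
  have mapsTo : ∀ τ ∈ transversePerms P, fixedFlat τ ∈ univ.filter
      fun Y : IntersectionPoset (braidArrangement n) =>
        ((Y.subspace : Set (Fin n → ℝ)) ∩ posetCone P).Nonempty :=
    fun τ hτ => mem_filter.2 ⟨mem_univ _, (meets_iff τ).2 hτ⟩
  rw [Poin, poincare_eq_sum, ← sum_fiberwise_of_maps_to mapsTo]
  refine sum_congr rfl fun Y hY => ?_
  rw [natAbs_moebius, ← sum_const]
  refine sum_congr ?_ fun τ hτ => ?_
  · ext τ
    simp only [mem_filter, mem_univ, true_and, iff_and_self] at hY ⊢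
    rintro rfl
    exact (meets_iff τ).1 hY
  · rw [← (mem_filter.1 hτ).2, codim]

end Braid

end PosetCone

open PosetCone in
theorem theorem1p2_general (n : ℕ) (P : Fin n → Fin n → Prop) :
    (∀ τ ∈ transversePerms P, ∃! xs, IsStandardForm P τ xs) ∧
    (∃ Φ : transversePerms P ≃ linearExtensions P,
      (∀ (τ : transversePerms P) (xs : List (Fin n)),
        IsStandardForm P τ.1 xs → List.ofFn (Φ τ).1 = eraseParentheses τ.1 xs) ∧
      (∀ τ : transversePerms P, cyc τ.1 = PLRmax P (Φ τ).1) ∧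
      ((∀ i j, ¬ StrictRel P i j) →
        (∀ τ : Equiv.Perm (Fin n), ∃ h : τ ∈ transversePerms P,
          List.ofFn (Φ ⟨τ, h⟩).1 = fundamentalWord τ) ∧
        ∀ σ : Equiv.Perm (Fin n), σ ∈ linearExtensions P ∧ PLRmax P σ = LRmax σ)) ∧
    Poin P = ∑ σ ∈ linearExtensions P, (Polynomial.X : Polynomial ℕ) ^ (n - PLRmax P σ) := by
  have hΦ := bijOn_standardWord P
  refine ⟨fun τ => existsUnique_isStandardForm, ⟨hΦ.equiv _, fun τ xs => ofFn_standardWord τ.2,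
    fun τ => cyc_eq_PLRmax_standardWord τ.2, fun hP => ⟨fun τ => ?_, fun σ => ?_⟩⟩, ?_⟩
  · exact ⟨mem_transversePerms_of_antichain hP τ, ofFn_standardWord_of_antichain hP τ⟩
  · exact ⟨mem_linearExtensions_of_antichain hP σ, PLRmax_eq_LRmax hP σ⟩
  · rw [Poin_eq_sum_transversePerms]
    exact Finset.sum_nbij (standardWord P) hΦ.mapsTo hΦ.injOn hΦ.surjOn fun τ hτ => by
      rw [cyc_eq_PLRmax_standardWord hτ]

theorem theorem1p2 (n : ℕ) (P : Fin n → Fin n → Prop) [IsPartialOrder (Fin n) P] :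
    (∀ τ ∈ PosetCone.transversePerms P, ∃! xs, PosetCone.IsStandardForm P τ xs) ∧
    (∃ Φ : PosetCone.transversePerms P ≃ PosetCone.linearExtensions P,
      (∀ (τ : PosetCone.transversePerms P) (xs : List (Fin n)),
        PosetCone.IsStandardForm P τ.1 xs →
          List.ofFn (Φ τ).1 = PosetCone.eraseParentheses τ.1 xs) ∧
      (∀ τ : PosetCone.transversePerms P, PosetCone.cyc τ.1 = PosetCone.PLRmax P (Φ τ).1) ∧
      ((∀ i j, ¬ PosetCone.StrictRel P i j) →
        (∀ τ : Equiv.Perm (Fin n), ∃ h : τ ∈ PosetCone.transversePerms P,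
          List.ofFn (Φ ⟨τ, h⟩).1 = PosetCone.fundamentalWord τ) ∧
        ∀ σ : Equiv.Perm (Fin n), σ ∈ PosetCone.linearExtensions P ∧
          PosetCone.PLRmax P σ = PosetCone.LRmax σ)) ∧
    PosetCone.Poin P =
      ∑ σ ∈ PosetCone.linearExtensions P,
        (Polynomial.X : Polynomial ℕ) ^ (n - PosetCone.PLRmax P σ) :=
  theorem1p2_general n P
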